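/- Conventions. A (set-theoretic) tree is a strictly partially ordered set $(Q,<)$ such that for every node $x\in Q$ the set $\{v\in Q: v<x\}$ is well-ordered by $<$. The sons of a node $x$ are its immediate successors. A branch is an inclusion-maximal chain. A foliage tree $\mathbf F$ is a tree together with a function assigning to each node $x$ a set $\mathbf F_x$, called the leaf at $x$. Let $X$ be a topological space. A $\pi$-tree on $X$ is a foliage tree $\mathbf F$ such that: 1. the underlying tree of $\mathbf F$ is isomorphic to the tree ${}^{<\omega}\omega$ of all finite sequences of natural numbers, ordered by proper end-extension; 2. every leaf $\mathbf F_x$ is an open subset of $X$, and the leaf at the least node is $X$; 3. for every non-maximal node $x$, the leaf $\mathbf F_x$ is the union of the leaves $\mathbf F_s$ over the sons $s$ of $x$, and the leaves at distinct sons of $x$ are disjoint; 4. for every branch $B$, the intersection $\bigcap_{x\in B}\mathbf F_x$ is a singleton; 5. for every point $p\in X$ and every neighbourhood $U$ of $p$ there is a node $z$ with $p\in\mathbf F_z$ such that, for some cofinite subset $A$ of the set of sons of $z$, $\varnothing\neq\bigcup_{s\in A}\mathbf F_s\subseteq U$. A space has a $\pi$-tree if there is a $\pi$-tree on it. Statement.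 Suppose that a topological space $X$ has a $\pi$-tree and $C\subseteq X$ is at most countable. Then the subspace $X\setminus C$ of $X$ also has a $\pi$-tree. -/

import Mathlib

open Set Topology

universe u v w

/-- A foliage tree whose skeleton is the strict partial order `<` on the node type `N` and whose
leaves are subsets of `X`: the set of predecessors of each node is well-ordered (so the skeleton
is a set-theoretic tree), and `leaf x` is the leaf at the node `x`. -/
structure FoliageTree (N : Type v) [PartialOrder N] (X : Type u) where
  pred_wellOrder : ∀ x : N, IsWellOrder (Iio x) (· < ·)
  leaf : N → Set X

namespace FoliageTree

variable {N : Type v} [PartialOrder N] {X : Type u}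

/-- The sons (immediate successors) of a node. -/
def sons (_F : FoliageTree N X) (x : N) : Set N := {s | x ⋖ s}

/-- The branches: the inclusion-maximal chains of nodes. -/
def branches (_F : FoliageTree N X) : Set (Set N) := {B | IsMaxChain (· ≤ ·) B}

/-- The intersection of the leaves over a set of nodes. -/
def fruit (F : FoliageTree N X) (A : Set N) : Set X := ⋂ x ∈ A, F.leaf x

/-- The union of the leaves over a set of nodes. -/
def flesh (F : FoliageTree N X) (A : Set N) : Set X := ⋃ x ∈ A, F.leaf x

/-- The unions of the leaves over the cofinite sets of sons of `z`. -/
def shoot (F : FoliageTree N X) (z : N) : Set (Set X) :=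
  {G | ∃ C : Set N, C ⊆ F.sons z ∧ (F.sons z \ C).Finite ∧ G = F.flesh C}

/-- The set of nodes whose leaf contains `p`. -/
def scope (F : FoliageTree N X) (p : X) : Set N := {y | p ∈ F.leaf y}

/-- Every branch has exactly one point in all of its leaves. -/
def HasStrictBranches (F : FoliageTree N X) : Prop :=
  Nonempty N ∧ ∀ B ∈ F.branches, ∃ p : X, F.fruit B = {p}

/-- The leaf at every non-maximal node is the disjoint union of the leaves at its sons. -/
def IsLocallyStrict (F : FoliageTree N X) : Prop :=
  ∀ x : N, ¬ IsMax x →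
    F.leaf x = ⋃ s ∈ F.sons x, F.leaf s ∧
    ∀ s ∈ F.sons x, ∀ t ∈ F.sons x, s ≠ t → F.leaf s ∩ F.leaf t = ∅

/-- The skeleton is isomorphic to the tree of finite sequences of natural numbers ordered by
proper end-extension. -/
def IsOmegaAlephZeroTree (_F : FoliageTree N X) : Prop :=
  Nonempty (((· < ·) : N → N → Prop) ≃r (fun s t : List ℕ => s <+: t ∧ s ≠ t))

variable [TopologicalSpace X]

def IsOpenIn (F : FoliageTree N X) : Prop := ∀ z : N, IsOpen (F.leaf z)

/-- Baire foliage tree on the space `X`; the last clause says that the leaf at the least node is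
the whole space. -/
def IsBaire (F : FoliageTree N X) : Prop :=
  F.IsOpenIn ∧ F.IsLocallyStrict ∧ F.IsOmegaAlephZeroTree ∧ F.HasStrictBranches ∧
    ∃ z : N, IsBot z ∧ F.leaf z = univ

end FoliageTree

/-- `PiRefines γ δ`: every nonempty member of `δ` includes a nonempty member of `γ`. -/
def PiRefines {X : Type u} (γ δ : Set (Set X)) : Prop :=
  ∀ D ∈ δ \ {∅}, ∃ G ∈ γ \ {∅}, G ⊆ D

namespace FoliageTree

variable {N : Type v} [PartialOrder N] {X : Type u} [TopologicalSpace X]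

def GrowsInto (F : FoliageTree N X) : Prop :=
  ∀ p : X, ∀ U ∈ 𝓝 p, ∃ z ∈ F.scope p, PiRefines (F.shoot z) {U}

/-- `F` is a π-tree on the space `X`. -/
def IsPiTree (F : FoliageTree N X) : Prop := F.IsBaire ∧ F.GrowsInto

end FoliageTree

/-- The space `X` has a π-tree (with nodes in the universe `v`). -/
def HasPiTree (X : Type u) [TopologicalSpace X] : Prop :=
  ∃ (N : Type v) (_ : PartialOrder N) (F : FoliageTree N X), F.IsPiTree

/-! A π-tree identifies `X` with Baire space under a topology in which cylinders are open
(`IsBaireScheme.exists_equiv`), and `C` becomes a countable set `D`. The leaves are regrouped so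
that each branch has exactly one point off `D`.

Deleting `c ∈ D` alone would empty the branch through `c`. So `c` gets a companion `q ∉ D` in the
same cylinder, and the two shrinking cylinders around `c` and `q` together form one leaf, a pair. At
each step one of the two cylinders is split and the roles swap. The branch that stays in pairs
forever shrinks to `{c, q}`, hence to `q` off `D`; every other son is an ordinary cylinder.

A branch that meets cylinders infinitely often shrinks to one point. Since the point of `D` of least
rank is always removed, a point of `D` on such a branch would eventually be chosen and trapped in
pairs. Both cases give `RemovalState.existsUnique_run`.

Growth survives because each cylinder around a surviving point is, at some moment, the one being
split (`RemovalState.exists_serves_run`): cofinitely many new sons then lie in any prescribed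
cofinite union of its old sons. -/

/-- The initial segment of length `n` of a sequence. -/
def initSeg (g : ℕ → ℕ) (n : ℕ) : List ℕ := (List.range n).map g

theorem initSeg_succ (g : ℕ → ℕ) (n : ℕ) : initSeg g (n + 1) = initSeg g n ++ [g n] := by
  simp [initSeg, List.range_succ]

@[simp] theorem length_initSeg (g : ℕ → ℕ) (n : ℕ) : (initSeg g n).length = n := by
  simp [initSeg]

theorem initSeg_congr {g h : ℕ → ℕ} {n : ℕ} (H : ∀ i < n, g i = h i) :
    initSeg g n = initSeg h n := by
  simpa [initSeg] using H

theorem initSeg_isPrefix_of_le (g : ℕ → ℕ) {m n : ℕ} (h : m ≤ n) : initSeg g m <+: initSeg g n := by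
  induction n, h using Nat.le_induction with
  | base => exact List.prefix_rfl
  | succ n _ ih => rw [initSeg_succ]; exact ih.trans (List.prefix_append _ _)

/-- Every list is an initial segment of the sequence that continues it with zeros. -/
theorem initSeg_getD (l : List ℕ) : initSeg (fun i => l.getD i 0) l.length = l := by
  apply List.ext_getElem
  · simp
  · intro i h1 h2
    simp [initSeg, h2]

/-- A scheme of subsets of `X` indexed by finite sequences: a partition at each node, and exactly
one point along each branch. -/
structure IsBaireScheme {X : Type u} (S : List ℕ → Set X) : Prop where
  nil : S [] = univ
  union : ∀ l, S l = ⋃ k, S (l ++ [k])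
  inj : ∀ l k k' x, x ∈ S (l ++ [k]) → x ∈ S (l ++ [k']) → k = k'
  branch : ∀ g : ℕ → ℕ, ∃ p, ⋂ n, S (initSeg g n) = {p}

namespace IsBaireScheme

variable {X : Type u} {S : List ℕ → Set X}

theorem subset (hS : IsBaireScheme S) (l : List ℕ) (k : ℕ) : S (l ++ [k]) ⊆ S l := by
  rw [hS.union l]; exact subset_iUnion (fun k => S (l ++ [k])) k

theorem nonempty (hS : IsBaireScheme S) (l : List ℕ) : (S l).Nonempty := by
  obtain ⟨p, hp⟩ := hS.branch (fun i => l.getD i 0)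
  have : p ∈ ⋂ n, S (initSeg (fun i => l.getD i 0) n) := by rw [hp]; rfl
  have h := mem_iInter.1 this l.length
  rw [initSeg_getD] at h
  exact ⟨p, h⟩

theorem exists_itinerary (hS : IsBaireScheme S) (x : X) :
    ∃ g : ℕ → ℕ, ∀ n, x ∈ S (initSeg g n) := by
  classical
  have hex : ∀ l, ∃ k, x ∈ S l → x ∈ S (l ++ [k]) := by
    intro l
    by_cases hl : x ∈ S l
    · rw [hS.union l] at hl
      obtain ⟨k, hk⟩ := mem_iUnion.1 hl
      exact ⟨k, fun _ => hk⟩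
    · exact ⟨0, fun h => absurd h hl⟩
  choose nxt hnxt using hex
  let L : ℕ → List ℕ := fun n => Nat.rec [] (fun _ l => l ++ [nxt l]) n
  have hL : ∀ n, initSeg (fun n => nxt (L n)) n = L n := by
    intro n
    induction n with
    | zero => rfl
    | succ n ih => rw [initSeg_succ, ih]
  refine ⟨fun n => nxt (L n), fun n => ?_⟩
  rw [hL]
  induction n with
  | zero => change x ∈ S []; rw [hS.nil]; trivial
  | succ n ih => exact hnxt _ ih

/-- The points of a space with a scheme are coded by the sequences of natural numbers. -/
theorem exists_equiv (hS : IsBaireScheme S) :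
    ∃ e : X ≃ (ℕ → ℕ), ∀ x g n, x ∈ S (initSeg g n) ↔ ∀ i < n, e x i = g i := by
  choose e he using hS.exists_itinerary
  have key : ∀ x g n, x ∈ S (initSeg g n) ↔ ∀ i < n, e x i = g i := by
    intro x g n
    constructor
    · induction n with
      | zero => intro _ i hi; omega
      | succ n ih =>
        intro h i hi
        rw [initSeg_succ] at h
        have h1 := ih (hS.subset _ _ h)
        rcases Nat.lt_succ_iff_lt_or_eq.1 hi with h2 | rfl
        · exact h1 i h2
        · have h3 := he x (i + 1)
          rw [initSeg_succ, initSeg_congr h1] at h3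
          exact hS.inj _ _ _ _ h3 h
    · intro h
      rw [← initSeg_congr h]
      exact he x n
  -- Injectivity is the "at most one" and surjectivity the "at least one" of the branch condition.
  refine ⟨Equiv.ofBijective e ⟨?_, ?_⟩, key⟩
  · intro x y hxy
    obtain ⟨p, hp⟩ := hS.branch (e x)
    have hx : x ∈ ⋂ n, S (initSeg (e x) n) := mem_iInter.2 (he x)
    have hy : y ∈ ⋂ n, S (initSeg (e x) n) := by rw [hxy]; exact mem_iInter.2 (he y)
    rw [hp] at hx hy
    exact hx.trans hy.symm
  · intro g
    obtain ⟨p, hp⟩ := hS.branch g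
    have h : p ∈ ⋂ n, S (initSeg g n) := by rw [hp]; rfl
    refine ⟨p, funext fun i => ?_⟩
    exact (key p g (i + 1)).1 (mem_iInter.1 h _) i (Nat.lt_succ_self i)

end IsBaireScheme

/-- The growth condition of a π-tree, for schemes. -/
def SchemeGrows {X : Type u} [TopologicalSpace X] (S : List ℕ → Set X) : Prop :=
  ∀ p, ∀ U ∈ 𝓝 p, ∃ l, p ∈ S l ∧ ∃ A : Set ℕ, A.Finite ∧ ∀ k ∉ A, S (l ++ [k]) ⊆ U

/-- A proper end-extension of a finite sequence extends one of its one-term extensions. -/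
theorem exists_append_singleton_prefix_of_ne {l m : List ℕ} (h : l <+: m) (hne : l ≠ m) :
    ∃ k, l ++ [k] <+: m := by
  obtain ⟨t, rfl⟩ := h
  cases t with
  | nil => simp at hne
  | cons k t => exact ⟨k, t, by simp⟩

/-! ### From π-trees to open schemes -/

section OfPiTree

variable {N : Type v} [PartialOrder N] {X : Type u}

/-- The covering relation under an isomorphism with the tree of finite sequences. -/
theorem covBy_iff_of_relIso
    (φ : ((· < ·) : N → N → Prop) ≃r (fun s t : List ℕ => s <+: t ∧ s ≠ t)) (x y : N) :
    x ⋖ y ↔ ∃ k, φ y = φ x ++ [k] := by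
  constructor
  · rintro ⟨h1, h2⟩
    obtain ⟨h3, h4⟩ := φ.map_rel_iff.2 h1
    obtain ⟨k, hk⟩ := exists_append_singleton_prefix_of_ne h3 h4
    refine ⟨k, ?_⟩
    by_contra hne
    have ha : x < φ.symm (φ x ++ [k]) := by
      rw [← φ.map_rel_iff]; simp
    have hb : φ.symm (φ x ++ [k]) < y := by
      rw [← φ.map_rel_iff]; simp only [RelIso.apply_symm_apply]
      exact ⟨hk, fun h => hne h.symm⟩
    exact h2 ha hb
  · rintro ⟨k, hk⟩
    refine ⟨by rw [← φ.map_rel_iff, hk]; simp, fun {z} h1 h2 => ?_⟩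
    rw [← φ.map_rel_iff] at h1 h2
    rw [hk] at h2
    obtain ⟨h3, h4⟩ := h2
    rcases List.prefix_concat_iff.1 h3 with h | h
    · exact h4 h
    · exact h1.2 (h1.1.eq_of_length_le h.length_le)

variable [TopologicalSpace X]

theorem FoliageTree.IsPiTree.exists_scheme {F : FoliageTree N X} (hF : F.IsPiTree) :
    ∃ S : List ℕ → Set X, IsBaireScheme S ∧ (∀ l, IsOpen (S l)) ∧ SchemeGrows S := by
  obtain ⟨⟨hopen, hloc, ⟨φ⟩, hbr, z, hz, hzX⟩, hgr⟩ := hF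
  have hcov := covBy_iff_of_relIso φ
  have hsons : ∀ l s, s ∈ F.sons (φ.symm l) ↔ ∃ k, s = φ.symm (l ++ [k]) := by
    intro l s
    change φ.symm l ⋖ s ↔ _
    rw [hcov]
    simp [RelIso.eq_symm_apply]
  have hle : ∀ x y : N, x ≤ y ↔ φ x <+: φ y := by
    intro x y
    rw [le_iff_lt_or_eq, ← φ.map_rel_iff]
    constructor
    · rintro (h | rfl)
      · exact h.1
      · exact List.prefix_rfl
    · intro h
      by_cases he : φ x = φ y
      · exact Or.inr (φ.injective he)
      · exact Or.inl ⟨h, he⟩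
  have hnomax : ∀ l, ¬ IsMax (φ.symm l) := by
    intro l hm
    have h := hm ((hle _ (φ.symm (l ++ [0]))).2 (by simp))
    rw [hle] at h
    simpa using h.length_le
  refine ⟨fun l => F.leaf (φ.symm l), ⟨?_, ?_, ?_, ?_⟩, fun l => hopen _, ?_⟩
  · have : φ.symm [] = z :=
      le_antisymm ((hle _ _).2 (by simp)) (hz _)
    simp [this, hzX]
  · intro l
    rw [(hloc _ (hnomax l)).1]
    ext x
    simp only [mem_iUnion, hsons]
    constructor
    · rintro ⟨_, ⟨k, rfl⟩, hx⟩; exact ⟨k, hx⟩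
    · rintro ⟨k, hx⟩; exact ⟨_, ⟨k, rfl⟩, hx⟩
  · intro l k k' x hx hx'
    by_contra hne
    have h := (hloc _ (hnomax l)).2 _ ((hsons l _).2 ⟨k, rfl⟩) _ ((hsons l _).2 ⟨k', rfl⟩)
      (fun h => hne (by simpa using φ.symm.injective h))
    have : x ∈ (∅ : Set X) := h ▸ ⟨hx, hx'⟩
    exact this
  · intro g
    have hB : range (fun n => φ.symm (initSeg g n)) ∈ F.branches := by
      constructor
      · rintro _ ⟨m, rfl⟩ _ ⟨n, rfl⟩ _
        simp only [hle, RelIso.apply_symm_apply]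
        exact (le_total m n).imp (initSeg_isPrefix_of_le g) (initSeg_isPrefix_of_le g)
      · intro t ht hsub
        refine subset_antisymm hsub fun x hx => ?_
        refine ⟨(φ x).length, ?_⟩
        -- A node comparable with the initial segment of its own length equals it.
        have h := ht.total hx (hsub ⟨(φ x).length, rfl⟩)
        simp only [hle, RelIso.apply_symm_apply] at h
        simp only [RelIso.symm_apply_eq]
        rcases h with h | h
        · exact (h.eq_of_length (by simp)).symm
        · exact h.eq_of_length (by simp)
    obtain ⟨p, hp⟩ := hbr.2 _ hB
    refine ⟨p, ?_⟩
    rw [← hp, FoliageTree.fruit, biInter_range]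
  · intro p U hU
    obtain ⟨y, hy, href⟩ := hgr p U hU
    obtain ⟨l, rfl⟩ := φ.symm.surjective y
    obtain ⟨G, ⟨⟨A, hA, hfin, rfl⟩, -⟩, hGU⟩ :=
      href U ⟨rfl, Set.Nonempty.ne_empty ⟨p, mem_of_mem_nhds hU⟩⟩
    refine ⟨l, hy, {k | φ.symm (l ++ [k]) ∉ A}, ?_, ?_⟩
    · refine Set.Finite.subset (hfin.preimage (f := fun k => φ.symm (l ++ [k])) ?_) ?_
      · intro k _ k' _ h
        simpa using φ.symm.injective h
      · intro k hk
        exact ⟨(hsons l _).2 ⟨k, rfl⟩, hk⟩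
    · intro k hk
      simp only [mem_ofPred_eq, not_not] at hk
      exact subset_trans (subset_biUnion_of_mem (u := F.leaf) hk) hGU

end OfPiTree

/-! ### From open schemes to π-trees -/

/-- The finite sequences of natural numbers, in an arbitrary universe, ordered by end-extension. -/
structure SeqNode : Type w where
  /-- The underlying list. -/
  toList : List ℕ

namespace SeqNode

instance : PartialOrder SeqNode.{w} where
  le x y := x.toList <+: y.toList
  le_refl x := List.prefix_rfl
  le_trans x y z := List.IsPrefix.trans
  le_antisymm := by
    rintro ⟨x⟩ ⟨y⟩ h h'
    exact congrArg mk (h.eq_of_length_le h'.length_le)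

theorem le_def {x y : SeqNode.{w}} : x ≤ y ↔ x.toList <+: y.toList := Iff.rfl

theorem toList_injective : Function.Injective SeqNode.toList.{w} := by
  rintro ⟨x⟩ ⟨y⟩ rfl; rfl

theorem lt_def {x y : SeqNode.{w}} : x < y ↔ x.toList <+: y.toList ∧ x.toList ≠ y.toList := by
  rw [lt_iff_le_and_ne, le_def, toList_injective.ne_iff]

/-- The nodes form the tree of finite sequences. -/
def relIso : ((· < ·) : SeqNode.{w} → SeqNode.{w} → Prop) ≃r
    (fun s t : List ℕ => s <+: t ∧ s ≠ t) where
  toFun := SeqNode.toList.{w}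
  invFun := SeqNode.mk.{w}
  left_inv _ := rfl
  right_inv _ := rfl
  map_rel_iff' := lt_def.{w}.symm

/-- Prefixes of one list are determined and ordered by their lengths. -/
theorem isWellOrder_Iio (x : SeqNode.{w}) : IsWellOrder (Iio x) (· < ·) := by
  have hlt : ∀ a b : Iio x, a.1.toList.length < b.1.toList.length ↔ a < b := by
    rintro ⟨a, ha⟩ ⟨b, hb⟩
    simp only [Subtype.mk_lt_mk, lt_def]
    constructor
    · intro h
      exact ⟨List.prefix_of_prefix_length_le (lt_def.1 ha).1 (lt_def.1 hb).1 h.le,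
        fun he => by simp [he] at h⟩
    · rintro ⟨h1, h2⟩
      exact lt_of_le_of_ne h1.length_le fun h => h2 (h1.eq_of_length h)
  have hinj : Function.Injective fun a : Iio x => a.1.toList.length := by
    rintro ⟨a, ha⟩ ⟨b, hb⟩ h
    apply Subtype.ext
    apply toList_injective
    exact (List.prefix_of_prefix_length_le (lt_def.1 ha).1 (lt_def.1 hb).1
      (le_of_eq h)).eq_of_length h
  exact RelEmbedding.isWellOrder
    (s := ((· < ·) : ℕ → ℕ → Prop)) ⟨⟨_, hinj⟩, fun {a b} => hlt a b⟩

theorem covBy_iff (x y : SeqNode.{w}) : x ⋖ y ↔ ∃ k, y = ⟨x.toList ++ [k]⟩ := by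
  rw [covBy_iff_of_relIso relIso]
  refine exists_congr fun k => ⟨fun h => toList_injective h, fun h => ?_⟩
  rw [h]; rfl

/-- The branches of the tree of finite sequences are given by the infinite sequences. -/
theorem exists_eq_range_initSeg {B : Set SeqNode.{w}} (hB : IsMaxChain (· ≤ ·) B) :
    ∃ g : ℕ → ℕ, B = range fun n => (⟨initSeg g n⟩ : SeqNode.{w}) := by
  have hmem : ∀ x, (∀ y ∈ B, x ≤ y ∨ y ≤ x) → x ∈ B := by
    intro x hx
    have h := hB.2 (hB.1.insert fun y hy _ => hx y hy) (subset_insert x B)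
    rw [h]; exact mem_insert x B
  have hlong : ∀ n, ∃ x ∈ B, n ≤ x.toList.length := by
    intro n
    induction n with
    | zero =>
      exact ⟨⟨[]⟩, hmem _ fun y _ => Or.inl (le_def.2 (by simp)), by simp⟩
    | succ n ih =>
      obtain ⟨x, hx, hn⟩ := ih
      by_contra hcon
      push Not at hcon
      -- If no member is longer than `n`, then `x` is the top of the chain, and maximality admits
      -- its extension.
      have h : (⟨x.toList ++ [0]⟩ : SeqNode.{w}) ∈ B := by
        refine hmem _ fun y hy => Or.inr ?_
        have hyx : y ≤ x := by
          rcases hB.1.total hy hx with h | h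
          · exact h
          · rw [le_def] at h ⊢
            rw [h.eq_of_length_le (by have := hcon y hy; omega)]
        exact le_def.2 ((le_def.1 hyx).trans (by simp))
      have := hcon _ h
      simp at this
      omega
  choose b hbB hb using hlong
  -- The default is never used: `b (i + 1)` has length at least `i + 1`.
  let g : ℕ → ℕ := fun i => (b (i + 1)).toList.getD i 0
  have hget : ∀ x ∈ B, ∀ i < x.toList.length, x.toList.getD i 0 = g i := by
    intro x hx i hi
    have h2 := hb (i + 1)
    have hi' : i < (b (i + 1)).toList.length := by omega
    simp only [g]
    rw [List.getD_eq_getElem _ _ hi, List.getD_eq_getElem _ _ hi']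
    rcases hB.1.total hx (hbB (i + 1)) with h | h
    · exact h.getElem hi
    · exact (h.getElem hi').symm
  have heq : ∀ x ∈ B, x.toList = initSeg g x.toList.length := by
    intro x hx
    rw [← initSeg_congr (hget x hx), initSeg_getD]
  refine ⟨g, subset_antisymm (fun x hx => ⟨_, toList_injective (heq x hx).symm⟩) ?_⟩
  rintro _ ⟨n, rfl⟩
  refine hmem _ fun y hy => ?_
  rw [le_def, le_def, heq y hy]
  exact (le_total n _).imp (initSeg_isPrefix_of_le g) (initSeg_isPrefix_of_le g)

end SeqNode

theorem IsBaireScheme.hasPiTree {X : Type u} [TopologicalSpace X] {S : List ℕ → Set X}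
    (hS : IsBaireScheme S) (hopen : ∀ l, IsOpen (S l)) (hgr : SchemeGrows S) :
    HasPiTree.{u, w} X := by
  let F : FoliageTree SeqNode.{w} X := ⟨SeqNode.isWellOrder_Iio, fun x => S x.toList⟩
  have hsons : ∀ x s, s ∈ F.sons x ↔ ∃ k, s = ⟨x.toList ++ [k]⟩ := SeqNode.covBy_iff
  refine ⟨SeqNode.{w}, inferInstance, F, ⟨fun x => hopen _, ?_, ⟨SeqNode.relIso⟩,
    ⟨⟨⟨[]⟩⟩, ?_⟩, ⟨[]⟩, fun x => SeqNode.le_def.2 (by simp), hS.nil⟩, ?_⟩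
  · intro x _
    constructor
    · change S x.toList = _
      rw [hS.union]
      ext p
      simp only [mem_iUnion, hsons]
      constructor
      · rintro ⟨k, hp⟩; exact ⟨_, ⟨k, rfl⟩, hp⟩
      · rintro ⟨_, ⟨k, rfl⟩, hp⟩; exact ⟨k, hp⟩
    · intro s hs t ht hst
      obtain ⟨k, rfl⟩ := (hsons _ _).1 hs
      obtain ⟨k', rfl⟩ := (hsons _ _).1 ht
      refine eq_empty_of_forall_notMem fun p hp => hst ?_
      rw [hS.inj _ _ _ _ hp.1 hp.2]
  · intro B hB
    obtain ⟨g, rfl⟩ := SeqNode.exists_eq_range_initSeg hB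
    obtain ⟨p, hp⟩ := hS.branch g
    refine ⟨p, ?_⟩
    rw [← hp, FoliageTree.fruit, biInter_range]
  · intro p U hU
    obtain ⟨l, hl, A, hA, hAU⟩ := hgr p U hU
    refine ⟨⟨l⟩, hl, ?_⟩
    rintro _ ⟨rfl, -⟩
    refine ⟨F.flesh ((fun k => ⟨l ++ [k]⟩) '' Aᶜ), ⟨⟨_, ?_, ?_, rfl⟩, ?_⟩, ?_⟩
    · rintro _ ⟨k, -, rfl⟩
      exact (hsons _ _).2 ⟨k, rfl⟩
    · refine (hA.image fun k => (⟨l ++ [k]⟩ : SeqNode.{w})).subset ?_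
      rintro s ⟨hs, hs'⟩
      obtain ⟨k, rfl⟩ := (hsons _ _).1 hs
      refine ⟨k, ?_, rfl⟩
      by_contra hk
      exact hs' ⟨k, hk, rfl⟩
    · obtain ⟨k, hk⟩ := hA.infinite_compl.nonempty
      obtain ⟨q, hq⟩ := hS.nonempty (l ++ [k])
      refine Set.Nonempty.ne_empty ⟨q, ?_⟩
      exact mem_biUnion (mem_image_of_mem _ hk) hq
    · refine iUnion₂_subset ?_
      rintro _ ⟨k, hk, rfl⟩
      exact hAU k hk

/-! ### Cylinders in Baire space -/

open PiNat in
theorem mem_cylinder_update_iff {f z : ℕ → ℕ} {n k : ℕ} :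
    z ∈ cylinder (Function.update f n k) (n + 1) ↔ z ∈ cylinder f n ∧ z n = k := by
  simp only [mem_cylinder_iff]
  constructor
  · intro h
    refine ⟨fun i hi => ?_, ?_⟩
    · rw [h i (by omega), Function.update_of_ne (by omega)]
    · rw [h n (by omega), Function.update_self]
  · rintro ⟨h1, h2⟩ i hi
    rcases Nat.lt_succ_iff_lt_or_eq.1 hi with h | rfl
    · rw [h1 i h, Function.update_of_ne (by omega)]
    · rw [h2, Function.update_self]

open PiNat in
theorem mem_cylinder_succ_iff {f z : ℕ → ℕ} {n : ℕ} :
    z ∈ cylinder f (n + 1) ↔ z ∈ cylinder f n ∧ z n = f n := by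
  rw [← mem_cylinder_update_iff, Function.update_eq_self]

/-- A countable set of sequences misses a point of every cylinder. -/
theorem Set.Countable.exists_notMem_cylinder {D : Set (ℕ → ℕ)} (hD : D.Countable) (f : ℕ → ℕ)
    (n a : ℕ) : ∃ q, q ∉ D ∧ q ∈ PiNat.cylinder f n ∧ q n = a := by
  by_contra! hcon
  -- A copy of Baire space inside the cylinder; were it contained in `D`, Cantor's diagonal would
  -- contradict countability.
  let j : (ℕ → ℕ) → (ℕ → ℕ) := fun h i =>
    if i < n then f i else if i = n then a else h (i - (n + 1))
  have hj : Function.Injective j := by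
    intro h h' hh
    funext i
    have := congrFun hh (i + (n + 1))
    have h1 : ¬ i + (n + 1) < n := by omega
    have h2 : ¬ i + (n + 1) = n := by omega
    simpa only [j, h1, h2, if_false, Nat.add_sub_cancel] using this
  have hjD : ∀ h, j h ∈ D := by
    intro h
    by_contra hn
    refine hcon _ hn (PiNat.mem_cylinder_iff.2 fun i hi => ?_) ?_
    · simp [j, hi]
    · simp [j]
  have h1 : (j ⁻¹' D).Countable := hD.preimage hj
  have h2 : j ⁻¹' D = univ := eq_univ_of_forall hjD
  rw [h2, countable_univ_iff] at h1
  obtain ⟨b, hb⟩ := exists_surjective_nat (ℕ → ℕ)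
  obtain ⟨m, hm⟩ := hb fun i => b i i + 1
  have := congrFun hm m
  simp at this

/-! ### The removal machine -/

/-- The states of the machine that removes the points of `D`: either a cylinder, or two disjoint
cylinders, exactly one of whose centers is to be removed. -/
inductive RemovalState (D : Set (ℕ → ℕ)) : Type
  | cyl (f : ℕ → ℕ) (n : ℕ)
  | pair (x : ℕ → ℕ) (i : ℕ) (y : ℕ → ℕ) (j : ℕ)
      (hdisj : Disjoint (PiNat.cylinder x i) (PiNat.cylinder y j)) (hx : x ∈ D ↔ y ∉ D)

namespace RemovalState

open PiNat

variable {D : Set (ℕ → ℕ)}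

/-- The set of sequences that pass through a state. -/
def leaf : RemovalState D → Set (ℕ → ℕ)
  | cyl f n => cylinder f n
  | pair x i y j _ _ => cylinder x i ∪ cylinder y j

/-- The successors of a pair of cylinders. -/
def pairSon (x : ℕ → ℕ) (i : ℕ) (y : ℕ → ℕ) (j : ℕ)
    (hdisj : Disjoint (cylinder x i) (cylinder y j)) (hx : x ∈ D ↔ y ∉ D) (k : ℕ) :
    RemovalState D :=
  -- The unsplit cylinder comes first in the new pair, so that it is split next.
  if k = x i then
    pair y j x (i + 1) (hdisj.symm.mono_right (cylinder_anti x i.le_succ))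
      (by rw [hx, not_not])
  else cyl (Function.update x i k) (i + 1)

/-- The successors of a cylinder when the point `c` is removed from it, the point `q` being its
companion. -/
def removeSon (f : ℕ → ℕ) (n : ℕ) (c q : ℕ → ℕ) (hc : c ∈ D) (hq : q ∉ D) (hqc : q n = c n + 1)
    (k : ℕ) : RemovalState D :=
  -- The values `c n` and `c n + 1` share the index `c n`; larger values move down by one, so every
  -- index is used.
  if k < c n then cyl (Function.update f n k) (n + 1)
  else if k = c n then
    pair c (n + 1) q (n + 1)
      (disjoint_left.2 fun z hz hz' => by
        rw [mem_cylinder_succ_iff] at hz hz'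
        have := hz.2.symm.trans hz'.2
        omega)
      (by simp [hc, hq])
  else cyl (Function.update f n (k + 1)) (n + 1)

open Classical in
/-- The successors of a state. In a cylinder that meets `D`, the point of `D` of least rank is
removed. -/
noncomputable def son (hD : D.Countable) (r : (ℕ → ℕ) → ℕ) : RemovalState D → ℕ → RemovalState D
  | cyl f n =>
    if h : (D ∩ cylinder f n).Nonempty then
      removeSon f n (Function.argminOn r _ h)
        (hD.exists_notMem_cylinder f n (Function.argminOn r _ h n + 1)).choose
        (Function.argminOn_mem r _ h).1
        (hD.exists_notMem_cylinder f n (Function.argminOn r _ h n + 1)).choose_spec.1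
        (hD.exists_notMem_cylinder f n (Function.argminOn r _ h n + 1)).choose_spec.2.2
    else fun k => cyl (Function.update f n k) (n + 1)
  | pair x i y j hdisj hx => pairSon x i y j hdisj hx

variable (hD : D.Countable) (r : (ℕ → ℕ) → ℕ)

theorem son_pair (x i y j hdisj hx) :
    son hD r (pair x i y j hdisj hx) = pairSon x i y j hdisj hx := rfl

theorem son_cyl_of_disjoint {f : ℕ → ℕ} {n : ℕ} (h : ¬ (D ∩ cylinder f n).Nonempty) :
    son hD r (cyl f n) = fun k => cyl (Function.update f n k) (n + 1) := by
  simp only [son, h, dite_false]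

theorem son_cyl_of_nonempty {f : ℕ → ℕ} {n : ℕ} (h : (D ∩ cylinder f n).Nonempty) :
    ∃ c q, ∃ (hc : c ∈ D) (hq : q ∉ D) (hqc : q n = c n + 1), c ∈ cylinder f n ∧
      q ∈ cylinder f n ∧ (∀ d ∈ D ∩ cylinder f n, r c ≤ r d) ∧
      son hD r (cyl f n) = removeSon f n c q hc hq hqc := by
  have hq := (hD.exists_notMem_cylinder f n (Function.argminOn r _ h n + 1)).choose_spec
  refine ⟨_, _, (Function.argminOn_mem r _ h).1, hq.1, hq.2.2,
    (Function.argminOn_mem r _ h).2, hq.2.1,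
    fun d hd => Function.argminOn_le r _ hd, ?_⟩
  simp only [son, h, dite_true]

theorem mem_leaf_pairSon_iff {x i y j} {hdisj : Disjoint (cylinder x i) (cylinder y j)}
    {hx : x ∈ D ↔ y ∉ D} {k : ℕ} {z : ℕ → ℕ} :
    z ∈ (pairSon x i y j hdisj hx k).leaf ↔
      (z ∈ cylinder x i ∧ z i = k) ∨ (z ∈ cylinder y j ∧ k = x i) := by
  unfold pairSon
  split_ifs with h
  · subst h
    simp only [leaf, mem_union, mem_cylinder_succ_iff (f := x)]
    tauto
  · simp only [leaf, mem_cylinder_update_iff]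
    tauto

theorem mem_leaf_removeSon_iff {f n c q} {hc : c ∈ D} {hq : q ∉ D} {hqc : q n = c n + 1}
    (hcf : c ∈ cylinder f n) (hqf : q ∈ cylinder f n) {k : ℕ} {z : ℕ → ℕ} :
    z ∈ (removeSon f n c q hc hq hqc k).leaf ↔
      z ∈ cylinder f n ∧ k = if z n ≤ c n then z n else z n - 1 := by
  have hc' : z ∈ cylinder c (n + 1) ↔ z ∈ cylinder f n ∧ z n = c n := by
    rw [mem_cylinder_succ_iff, mem_cylinder_iff_eq.1 hcf]
  have hq' : z ∈ cylinder q (n + 1) ↔ z ∈ cylinder f n ∧ z n = c n + 1 := by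
    rw [mem_cylinder_succ_iff, mem_cylinder_iff_eq.1 hqf, hqc]
  unfold removeSon
  by_cases hz : z ∈ cylinder f n <;> split_ifs <;>
    simp only [leaf, mem_union, mem_cylinder_update_iff, hc', hq', hz, true_and, false_and,
      or_self] <;> omega

theorem mem_leaf_iff_exists_son (s : RemovalState D) (z : ℕ → ℕ) :
    z ∈ s.leaf ↔ ∃ k, z ∈ (son hD r s k).leaf := by
  cases s with
  | cyl f n =>
    by_cases h : (D ∩ cylinder f n).Nonempty
    · obtain ⟨c, q, hc, hq, hqc, hcf, hqf, -, hson⟩ := son_cyl_of_nonempty hD r h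
      change z ∈ cylinder f n ↔ _
      simp only [hson, mem_leaf_removeSon_iff hcf hqf, exists_and_left, exists_eq, and_true]
    · simp only [son_cyl_of_disjoint hD r h, leaf, mem_cylinder_update_iff, exists_and_left,
        exists_eq', and_true]
  | pair x i y j hdisj hx =>
    change z ∈ cylinder x i ∨ z ∈ cylinder y j ↔ _
    simp only [son_pair, mem_leaf_pairSon_iff, exists_or, exists_and_left,
      exists_eq, exists_eq', and_true]

theorem leaf_son_subset (s : RemovalState D) (k : ℕ) : (son hD r s k).leaf ⊆ s.leaf :=
  fun z hz => (mem_leaf_iff_exists_son hD r s z).2 ⟨k, hz⟩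

theorem leaf_son_inj (s : RemovalState D) {k k' : ℕ} {z : ℕ → ℕ}
    (hz : z ∈ (son hD r s k).leaf) (hz' : z ∈ (son hD r s k').leaf) : k = k' := by
  cases s with
  | cyl f n =>
    by_cases h : (D ∩ cylinder f n).Nonempty
    · obtain ⟨c, q, hc, hq, hqc, hcf, hqf, -, hson⟩ := son_cyl_of_nonempty hD r h
      rw [hson, mem_leaf_removeSon_iff hcf hqf] at hz hz'
      exact hz.2.trans hz'.2.symm
    · simp only [son_cyl_of_disjoint hD r h, leaf, mem_cylinder_update_iff] at hz hz'
      exact hz.2.symm.trans hz'.2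
  | pair x i y j hdisj hx =>
    rw [son_pair, mem_leaf_pairSon_iff] at hz hz'
    have hd : z ∈ cylinder x i → z ∉ cylinder y j := fun h h' => disjoint_left.1 hdisj h h'
    rcases hz with ⟨h1, h2⟩ | ⟨h1, h2⟩ <;> rcases hz' with ⟨h3, h4⟩ | ⟨h3, h4⟩
    · exact h2.symm.trans h4
    · exact absurd h3 (hd h1)
    · exact absurd h1 (hd h3)
    · exact h2.trans h4.symm

/-- A lower bound for the lengths of the cylinders of a state. -/
def size : RemovalState D → ℕ
  | cyl _ n => n
  | pair _ i _ j _ _ => min i j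

/-- The strict increase on arrival in a cylinder makes the lengths unbounded on a run with
infinitely many cylinders. -/
theorem size_son (s : RemovalState D) (k : ℕ) :
    s.size ≤ (son hD r s k).size ∧ ∀ f n, son hD r s k = cyl f n → s.size < n := by
  cases s with
  | cyl f n =>
    by_cases h : (D ∩ cylinder f n).Nonempty
    · obtain ⟨c, q, hc, hq, hqc, hcf, hqf, -, hson⟩ := son_cyl_of_nonempty hD r h
      rw [hson, removeSon]
      split_ifs <;> simp +contextual [size]
    · rw [son_cyl_of_disjoint hD r h]
      simp only [size, cyl.injEq]
      exact ⟨by omega, by rintro _ _ ⟨-, rfl⟩; omega⟩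
  | pair x i y j hdisj hx =>
    rw [son_pair, pairSon]
    split_ifs
    · simp [size]
    · simp only [size, cyl.injEq]
      exact ⟨by omega, by rintro _ _ ⟨-, rfl⟩; omega⟩

/-! ### Preserving the growth condition -/

/-- All but finitely many successors of the state lie in the cylinder of length `n` around `p` and
have the `n`-th coordinate off a given finite set. -/
def Serves (s : RemovalState D) (p : ℕ → ℕ) (n : ℕ) : Prop :=
  ∀ F : Set ℕ, F.Finite → ∃ A : Set ℕ, A.Finite ∧
    ∀ k ∉ A, ∀ z ∈ (son hD r s k).leaf, z ∈ cylinder p n ∧ z n ∉ F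

open Classical in
/-- The length of the cylinder of a state that contains `p`. -/
noncomputable def level (p : ℕ → ℕ) : RemovalState D → ℕ
  | cyl _ n => n
  | pair x i _ j _ _ => if p ∈ cylinder x i then i else j

/-- The point `p` lies in the cylinder of the state that is to be split. -/
def Direct (p : ℕ → ℕ) : RemovalState D → Prop
  | cyl _ _ => True
  | pair x i _ _ _ _ => p ∈ cylinder x i

theorem serves_of_direct {s : RemovalState D} {p : ℕ → ℕ} (hp : p ∈ s.leaf) (hd : s.Direct p) :
    s.Serves hD r p (s.level p) := by
  intro F hF
  cases s with
  | cyl f n =>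
    simp only [level]
    have hpf : p ∈ cylinder f n := hp
    rw [mem_cylinder_iff_eq.1 hpf]
    by_cases h : (D ∩ cylinder f n).Nonempty
    · obtain ⟨c, q, hc, hq, hqc, hcf, hqf, -, hson⟩ := son_cyl_of_nonempty hD r h
      -- The index of the son through `z` is `z n` or `z n - 1`.
      refine ⟨F ∪ (fun m => m - 1) '' F, hF.union (hF.image _), fun k hk z hz => ?_⟩
      rw [hson, mem_leaf_removeSon_iff hcf hqf] at hz
      refine ⟨hz.1, fun hzF => hk ?_⟩
      rw [hz.2]
      split_ifs
      · exact Or.inl hzF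
      · exact Or.inr ⟨_, hzF, rfl⟩
    · refine ⟨F, hF, fun k hk z hz => ?_⟩
      simp only [son_cyl_of_disjoint hD r h, leaf, mem_cylinder_update_iff] at hz
      exact ⟨hz.1, hz.2 ▸ hk⟩
  | pair x i y j hdisj hx =>
    have hpx : p ∈ cylinder x i := hd
    simp only [level, hpx, if_true]
    rw [mem_cylinder_iff_eq.1 hpx]
    -- Only the son with index `x i` reaches outside the cylinder around `p`.
    refine ⟨insert (x i) F, hF.insert _, fun k hk z hz => ?_⟩
    simp only [mem_insert_iff, not_or] at hk
    rw [son_pair, mem_leaf_pairSon_iff] at hz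
    rcases hz with h | h
    · exact ⟨h.1, h.2 ▸ hk.2⟩
    · exact absurd h.2 hk.1

/-- In a pair, `p` is off the other cylinder by disjointness, so after the swap its level is still
read from the cylinder just lengthened. -/
theorem level_son_of_direct {s : RemovalState D} {p : ℕ → ℕ} {k : ℕ} (hd : s.Direct p) :
    (son hD r s k).level p = s.level p + 1 := by
  cases s with
  | cyl f n =>
    by_cases h : (D ∩ cylinder f n).Nonempty
    · obtain ⟨c, q, hc, hq, hqc, hcf, hqf, -, hson⟩ := son_cyl_of_nonempty hD r h
      rw [hson, removeSon]
      split_ifs <;> simp [level]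
    · simp only [son_cyl_of_disjoint hD r h, level]
  | pair x i y j hdisj hx =>
    have hpx : p ∈ cylinder x i := hd
    have hpy : p ∉ cylinder y j := disjoint_left.1 hdisj hpx
    rw [son_pair, pairSon]
    split_ifs <;> simp only [level, hpx, hpy, if_true, if_false]

/-- Only the swapping son contains `p`, and it keeps the cylinder of `p` unchanged. Thus no level is
skipped before it is served. -/
theorem son_of_not_direct {s : RemovalState D} {p : ℕ → ℕ} {k : ℕ} (hd : ¬ s.Direct p)
    (hp : p ∈ (son hD r s k).leaf) :
    (son hD r s k).Direct p ∧ (son hD r s k).level p = s.level p := by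
  cases s with
  | cyl f n => exact absurd trivial hd
  | pair x i y j hdisj hx =>
    have hpx : p ∉ cylinder x i := hd
    rw [son_pair, mem_leaf_pairSon_iff] at hp
    simp only [hpx, false_and, false_or] at hp
    simp only [son_pair, pairSon, hp.2, if_true, level, Direct, hpx, hp.1, if_false, and_self]

/-! ### Points on infinite runs -/

section Run

variable {hD r} {s : ℕ → RemovalState D} {g : ℕ → ℕ}

theorem leaf_run_antitone (hs : ∀ t, s (t + 1) = son hD r (s t) (g t)) :
    Antitone fun t => (s t).leaf :=
  antitone_nat_of_succ_le fun t => by rw [hs]; exact leaf_son_subset hD r _ _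

theorem size_run_monotone (hs : ∀ t, s (t + 1) = son hD r (s t) (g t)) :
    Monotone fun t => (s t).size :=
  monotone_nat_of_le_succ fun t => by rw [hs]; exact (size_son hD r _ _).1

/-- Every length is served along the run of a point. -/
theorem exists_serves_run (h0 : s 0 = cyl 0 0) (hs : ∀ t, s (t + 1) = son hD r (s t) (g t))
    {p : ℕ → ℕ} (hp : ∀ t, p ∈ (s t).leaf) (n : ℕ) : ∃ t, (s t).Serves hD r p n := by
  have direct : ∀ n, (∃ t, (s t).level p = n) → ∃ t, (s t).Direct p ∧ (s t).level p = n := by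
    rintro n ⟨t, rfl⟩
    by_cases hd : (s t).Direct p
    · exact ⟨t, hd, rfl⟩
    · have h := hp (t + 1)
      rw [hs] at h
      refine ⟨t + 1, ?_⟩
      rw [hs]
      exact son_of_not_direct hD r hd h
  have hlevel : ∀ n, ∃ t, (s t).level p = n := by
    intro n
    induction n with
    | zero => exact ⟨0, by rw [h0]; rfl⟩
    | succ n ih =>
      obtain ⟨t, hd, ht⟩ := direct n ih
      exact ⟨t + 1, by rw [hs, level_son_of_direct hD r hd, ht]⟩
  obtain ⟨t, hd, rfl⟩ := direct n (hlevel n)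
  exact ⟨t, serves_of_direct hD r (hp t) hd⟩

/-- A run that consists of pairs of cylinders from some moment on has exactly one point off `D`. -/
theorem existsUnique_of_eventually_pair (hs : ∀ t, s (t + 1) = son hD r (s t) (g t)) {N : ℕ}
    (hN : ∀ t ≥ N, ∀ f n, s t ≠ cyl f n) :
    ∃ p ∉ D, (∀ t, p ∈ (s t).leaf) ∧ ∀ z ∉ D, (∀ t, z ∈ (s t).leaf) → z = p := by
  have step : ∀ t ≥ N, ∀ x i y j h h', s t = pair x i y j h h' →
      ∃ h h', s (t + 1) = pair y j x (i + 1) h h' := by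
    intro t ht x i y j h h' hst
    have h1 := hN (t + 1) (by omega)
    rw [hs, hst, son_pair, pairSon] at h1 ⊢
    split_ifs at h1 ⊢ with hk
    · exact ⟨h.symm.mono_right (cylinder_anti x i.le_succ), by rw [h', not_not], rfl⟩
    · exact absurd rfl (h1 _ _)
  obtain ⟨x, i, y, j, h, hx, hst⟩ : ∃ x i y j h h', s N = pair x i y j h h' := by
    cases hsN : s N with
    | cyl f n => exact absurd hsN (hN N le_rfl f n)
    | pair x i y j h h' => exact ⟨x, i, y, j, h, h', rfl⟩
  -- Two swaps restore the order and lengthen each cylinder by one.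
  have hall : ∀ m, ∃ h h', s (N + 2 * m) = pair x (i + m) y (j + m) h h' := by
    intro m
    induction m with
    | zero => exact ⟨h, hx, hst⟩
    | succ m ih =>
      obtain ⟨h1, h2, h3⟩ := ih
      obtain ⟨h1, h2, h3⟩ := step _ (by omega) _ _ _ _ _ _ h3
      exact step (N + 2 * m + 1) (by omega) _ _ _ _ _ _ h3
  have hleaf : ∀ z, (∀ t, z ∈ (s t).leaf) ↔ z = x ∨ z = y := by
    intro z
    constructor
    · intro hz
      by_contra! hne
      obtain ⟨a, ha⟩ := Function.ne_iff.1 hne.1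
      obtain ⟨b, hb⟩ := Function.ne_iff.1 hne.2
      obtain ⟨h1, h2, h3⟩ := hall (max a b + 1)
      have h4 := hz (N + 2 * (max a b + 1))
      rw [h3] at h4
      rcases h4 with h4 | h4
      · exact ha (mem_cylinder_iff.1 h4 a (by omega))
      · exact hb (mem_cylinder_iff.1 h4 b (by omega))
    · intro hz t
      obtain ⟨h1, h2, h3⟩ := hall t
      refine leaf_run_antitone hs (show t ≤ N + 2 * t by omega) ?_
      simp only [h3]
      rcases hz with rfl | rfl
      · exact Or.inl (self_mem_cylinder _ _)
      · exact Or.inr (self_mem_cylinder _ _)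
  simp only [hleaf]
  by_cases hy : y ∈ D
  · refine ⟨x, fun h => hx.1 h hy, Or.inl rfl, ?_⟩
    rintro z hz (rfl | rfl)
    · rfl
    · exact absurd hy hz
  · refine ⟨y, hy, Or.inr rfl, ?_⟩
    rintro z hz (rfl | rfl)
    · exact absurd (hx.2 hy) hz
    · rfl

/-- A run with infinitely many cylinders shrinks to a point. -/
theorem existsUnique_of_frequently_cyl (hs : ∀ t, s (t + 1) = son hD r (s t) (g t))
    (hN : ∀ N, ∃ t ≥ N, ∃ f n, s t = cyl f n) :
    ∃ p, (∀ t, p ∈ (s t).leaf) ∧ ∀ z, (∀ t, z ∈ (s t).leaf) → z = p := by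
  have hlong : ∀ m, ∃ t f n, s t = cyl f n ∧ m ≤ n := by
    intro m
    induction m with
    | zero =>
      obtain ⟨t, -, f, n, h⟩ := hN 0
      exact ⟨t, f, n, h, by omega⟩
    | succ m ih =>
      obtain ⟨t, f, n, h, hm⟩ := ih
      obtain ⟨t', ht', f', n', h'⟩ := hN (t + 1)
      obtain ⟨t'', rfl⟩ : ∃ t'', t' = t'' + 1 := ⟨t' - 1, by omega⟩
      have h1 : (s t).size ≤ (s t'').size := size_run_monotone hs (by omega)
      -- The step into this later cylinder strictly raises the size, so `n < n'`.
      have h2 := (size_son hD r (s t'') (g t'')).2 f' n' (by rw [← hs, h'])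
      rw [h] at h1
      change n ≤ _ at h1
      exact ⟨_, f', n', h', by omega⟩
  choose t f n hst hn using hlong
  -- Coordinate `i` is read from a cylinder of length at least `i + 1`, where it is fixed.
  have hcyl : ∀ t' f' n', s t' = cyl f' n' → (fun i => f (i + 1) i) ∈ cylinder f' n' := by
    intro t' f' n' h'
    refine mem_cylinder_iff.2 fun i hi => ?_
    rcases le_total t' (t (i + 1)) with h | h
    · have h1 := leaf_run_antitone hs h
      simp only [h', hst, leaf] at h1
      exact mem_cylinder_iff.1 (h1 (self_mem_cylinder _ _)) i hi
    · have h1 := leaf_run_antitone hs h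
      simp only [h', hst, leaf] at h1
      exact (mem_cylinder_iff.1 (h1 (self_mem_cylinder _ _)) i (hn _)).symm
  refine ⟨fun i => f (i + 1) i, fun t' => ?_, fun z hz => funext fun i => ?_⟩
  · obtain ⟨t'', ht'', f', n', h'⟩ := hN t'
    refine leaf_run_antitone hs ht'' ?_
    simp only [h']
    exact hcyl _ _ _ h'
  · have h1 := hz (t (i + 1))
    rw [hst] at h1
    exact mem_cylinder_iff.1 h1 i (hn _)

/-- A run with a center of a pair in all of its leaves consists of pairs from that moment on. -/
theorem pair_of_center_mem (hs : ∀ t, s (t + 1) = son hD r (s t) (g t)) {p : ℕ → ℕ}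
    (hp : ∀ t, p ∈ (s t).leaf) {t₀ : ℕ}
    (h₀ : ∃ x i y j h h', s t₀ = pair x i y j h h' ∧ (p = x ∨ p = y)) {t : ℕ} (ht : t₀ ≤ t) :
    ∃ x i y j h h', s t = pair x i y j h h' ∧ (p = x ∨ p = y) := by
  induction t, ht using Nat.le_induction with
  | base => exact h₀
  | succ t _ ih =>
    obtain ⟨x, i, y, j, h, h', hst, hxy⟩ := ih
    have h1 := hp (t + 1)
    rw [hs, hst, son_pair, mem_leaf_pairSon_iff] at h1
    have hk : g t = x i := by
      rcases h1 with h1 | h1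
      · rcases hxy with rfl | rfl
        · exact h1.2.symm
        · exact absurd (self_mem_cylinder p j) (disjoint_left.1 h h1.1)
      · exact h1.2
    rw [hs, hst, son_pair, pairSon, if_pos hk]
    exact ⟨_, _, _, _, _, _, rfl, hxy.symm⟩

/-- A point of `D` does not lie in infinitely many cylinders of a run. -/
theorem notMem_of_frequently_cyl (hr : InjOn r D) (hs : ∀ t, s (t + 1) = son hD r (s t) (g t))
    (hN : ∀ N, ∃ t ≥ N, ∃ f n, s t = cyl f n) {p : ℕ → ℕ} (hp : ∀ t, p ∈ (s t).leaf)
    (huniq : ∀ z, (∀ t, z ∈ (s t).leaf) → z = p) : p ∉ D := by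
  intro hpD
  have hfin : {d | d ∈ D ∧ r d < r p}.Finite :=
    Set.Finite.of_finite_image ((finite_Iio (r p)).subset (by rintro _ ⟨d, hd, rfl⟩; exact hd.2))
      (hr.mono fun d hd => hd.1)
  have hev : ∀ᶠ t in Filter.atTop, ∀ d ∈ {d | d ∈ D ∧ r d < r p}, d ∉ (s t).leaf := by
    refine (Filter.eventually_all_finite hfin).2 fun d hd => ?_
    have hne : ∃ t, d ∉ (s t).leaf := by
      by_contra! h
      exact absurd hd.2 (by rw [huniq d h]; exact lt_irrefl _)
    obtain ⟨t, ht⟩ := hne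
    exact Filter.eventually_atTop.2 ⟨t, fun t' ht' h => ht (leaf_run_antitone hs ht' h)⟩
  obtain ⟨T, hT⟩ := Filter.eventually_atTop.1 hev
  obtain ⟨t, ht, f, n, hst⟩ := hN T
  have hpf : p ∈ cylinder f n := by have := hp t; rwa [hst] at this
  obtain ⟨c, q, hc, hq, hqc, hcf, hqf, hmin, hson⟩ :=
    son_cyl_of_nonempty hD r (⟨p, hpD, hpf⟩ : (D ∩ cylinder f n).Nonempty)
  -- By time `T` every point of `D` of smaller rank has left the run, so `p` is the one removed.
  have hcp : c = p := by
    refine hr hc hpD (le_antisymm (hmin p ⟨hpD, hpf⟩) (not_lt.1 fun hlt => ?_))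
    refine hT t ht c ⟨hc, hlt⟩ ?_
    rw [hst]; exact hcf
  subst hcp
  have h1 := hp (t + 1)
  rw [hs, hst, hson, mem_leaf_removeSon_iff hcf hqf, if_pos le_rfl] at h1
  have h2 : ∃ x i y j h h', s (t + 1) = pair x i y j h h' ∧ (c = x ∨ c = y) := by
    rw [hs, hst, hson, removeSon, if_neg (by omega), if_pos h1.2]
    exact ⟨_, _, _, _, _, _, rfl, Or.inl rfl⟩
  -- As a center of a pair, the point keeps the run in pairs forever, against the recurrence of
  -- cylinders.
  obtain ⟨t', ht', f', n', h'⟩ := hN (t + 1)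
  obtain ⟨x, i, y, j, h3, h4, h5, -⟩ := pair_of_center_mem hs hp h2 ht'
  rw [h'] at h5
  cases h5

/-- Every run has exactly one point off `D`. -/
theorem existsUnique_run (hr : InjOn r D) (hs : ∀ t, s (t + 1) = son hD r (s t) (g t)) :
    ∃ p ∉ D, (∀ t, p ∈ (s t).leaf) ∧ ∀ z ∉ D, (∀ t, z ∈ (s t).leaf) → z = p := by
  by_cases h : ∃ N, ∀ t ≥ N, ∀ f n, s t ≠ cyl f n
  · obtain ⟨N, hN⟩ := h
    exact existsUnique_of_eventually_pair hs hN
  · push Not at h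
    obtain ⟨p, hp, huniq⟩ := existsUnique_of_frequently_cyl hs h
    exact ⟨p, notMem_of_frequently_cyl hr hs h hp huniq, hp, fun z _ => huniq z⟩

end Run

/-! ### The new scheme and the conclusion -/

/-- The state reached from the whole space along a finite sequence. -/
noncomputable def runList (l : List ℕ) : RemovalState D := l.foldl (son hD r) (cyl 0 0)

theorem runList_append (l : List ℕ) (k : ℕ) :
    runList hD r (l ++ [k]) = son hD r (runList hD r l) k := by
  simp [runList]

theorem runList_initSeg_succ (g : ℕ → ℕ) (t : ℕ) :
    runList hD r (initSeg g (t + 1)) = son hD r (runList hD r (initSeg g t)) (g t) := by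
  rw [initSeg_succ, runList_append]

/-- The sets of the points off `D` that pass through the states form a scheme. -/
theorem isBaireScheme_runList (hr : InjOn r D) :
    IsBaireScheme fun l => {x : (Dᶜ : Set (ℕ → ℕ)) | x.1 ∈ (runList hD r l).leaf} where
  nil := eq_univ_of_forall fun x => by simp [runList, leaf]
  union l := by
    ext x
    simp only [runList_append, mem_iUnion, mem_ofPred_eq]
    exact mem_leaf_iff_exists_son hD r _ _
  inj l k k' x hx hx' := by
    simp only [runList_append] at hx hx'
    exact leaf_son_inj hD r _ hx hx'
  branch g := by
    obtain ⟨p, hpD, hp, huniq⟩ := existsUnique_run (s := fun t => runList hD r (initSeg g t)) hr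
      (runList_initSeg_succ hD r g)
    refine ⟨⟨p, hpD⟩, subset_antisymm (fun z hz => Subtype.ext ?_) ?_⟩
    · exact huniq _ z.2 fun t => mem_iInter.1 hz t
    · rintro _ rfl
      exact mem_iInter.2 hp

theorem isOpen_leaf {X : Type u} [TopologicalSpace X] {e : X → ℕ → ℕ}
    (he : ∀ f n, IsOpen (e ⁻¹' cylinder f n)) (s : RemovalState D) : IsOpen (e ⁻¹' s.leaf) := by
  cases s with
  | cyl f n => exact he f n
  | pair x i y j _ _ => exact (he x i).union (he y j)

end RemovalState

theorem IsBaireScheme.comp_equiv {X : Type u} {Y : Type v} {S : List ℕ → Set Y}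
    (hS : IsBaireScheme S) (e : X ≃ Y) : IsBaireScheme fun l => e ⁻¹' S l where
  nil := by simp [hS.nil]
  union l := by rw [hS.union l, preimage_iUnion]
  inj l k k' x := hS.inj l k k' (e x)
  branch g := by
    obtain ⟨p, hp⟩ := hS.branch g
    refine ⟨e.symm p, ?_⟩
    rw [← preimage_iInter, hp]
    ext x
    simp [Equiv.eq_symm_apply]

theorem mainTheorem4 {X : Type u} [TopologicalSpace X] (hX : HasPiTree.{u, v} X)
    (C : Set X) (hC : C.Countable) :
    HasPiTree.{u, w} (Cᶜ : Set X) := by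
  obtain ⟨N, _, F, hF⟩ := hX
  obtain ⟨S, hS, hopen, hgr⟩ := hF.exists_scheme
  obtain ⟨e, he⟩ := hS.exists_equiv
  have hecyl : ∀ f n, e ⁻¹' PiNat.cylinder f n = S (initSeg f n) := by
    intro f n
    ext x
    rw [he, mem_preimage, PiNat.mem_cylinder_iff]
  have hD : (e '' C).Countable := hC.image e
  obtain ⟨r, hr⟩ := countable_iff_exists_injOn.1 hD
  let e' : (Cᶜ : Set X) ≃ ((e '' C)ᶜ : Set (ℕ → ℕ)) :=
    e.subtypeEquiv fun x => by simp
  have hS' := (RemovalState.isBaireScheme_runList hD r hr).comp_equiv e'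
  refine hS'.hasPiTree (fun l => ?_) fun p U hU => ?_
  · exact (RemovalState.isOpen_leaf (fun f n => (hecyl f n).symm ▸ hopen _) _).preimage
      continuous_subtype_val
  · obtain ⟨V, hV, hVU⟩ := mem_nhds_subtype _ p U |>.1 hU
    obtain ⟨l, hpl, A, hA, hAV⟩ := hgr p.1 V hV
    obtain ⟨g, hg⟩ := hS'.exists_itinerary p
    obtain ⟨t, ht⟩ := RemovalState.exists_serves_run
      (s := fun t => RemovalState.runList hD r (initSeg g t)) (p := e p.1) rfl
      (RemovalState.runList_initSeg_succ hD r g) hg l.length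
    -- Off `B`, points of the new sons extend `l` and have next coordinate off `A`, so they lie in
    -- old sons contained in `V`.
    obtain ⟨B, hB, hBA⟩ := ht A hA
    refine ⟨initSeg g t, hg t, B, hB, fun k hk z hz => hVU ?_⟩
    simp only [RemovalState.runList_append] at hz
    obtain ⟨h1, h2⟩ := hBA k hk _ hz
    refine hAV (e z.1 l.length) h2 ?_
    have hl : initSeg (e z.1) l.length = l := by
      rw [← initSeg_getD l, he] at hpl
      rw [← initSeg_getD l]
      simp only [length_initSeg]
      exact initSeg_congr fun i hi =>
        ((PiNat.mem_cylinder_iff.1 h1) i hi).trans (hpl i (by simpa using hi))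
    have h3 := (he z.1 (e z.1) (l.length + 1)).2 fun _ _ => rfl
    rwa [initSeg_succ, hl] at h3
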